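/- Let $H\in(1/2,1]$ and $\lambda,\sigma>0$. Let $(B_H(t))_{t\in\mathbb R}$ be a fractional Brownian motion with Hurst parameter $H$, i.e. an almost surely continuous centered Gaussian process with $\mathbb E(B_H(t)B_H(s))=\frac12\left(|t|^{2H}+|s|^{2H}-|t-s|^{2H}\right)$ for $s,t\in\mathbb R$, and let $(X_t)_{t\in\mathbb R}\sim\mathrm{FOU}(\lambda,\sigma,H)$ be the fractional Ornstein–Uhlenbeck process $$X_t=\sigma\int_{-\infty}^t e^{-\lambda(t-s)}\,dB_H(s)\quad\text{almost surely, for each } t\in\mathbb R,$$ where the integral is the pathwise improper Riemann–Stieltjes integral (the limit as $a\to-\infty$ of the Riemann–Stieltjes integrals over $[a,t]$). For $x\ge 0$ put $$f_H(x)=e^{-x}\left(\Gamma(2H)-\int_0^x e^{s}s^{2H-1}\,ds\right)+e^{x}\left(\Gamma(2H)-\int_0^x e^{-s}s^{2H-1}\,ds\right).$$ Then every $X_t$ is square integrable with mean zero, and for every $t\in\mathbb R$ $$\mathbb E(X_0X_t)=\frac{\sigma^2 H\,f_H(\lambda|t|)}{2\lambda^{2H}},\qquad \mathbb V(X_t)=\frac{\sigma^2\,\Gamma(2H+1)}{2\lambda^{2H}}.$$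 -/

import Mathlib

open MeasureTheory ProbabilityTheory Filter Topology

noncomputable section

/-- A fractional Brownian motion on the whole line with Hurst parameter `H ∈ (0, 1]`:
an almost surely continuous centred Gaussian process with covariance
`(|t|^{2H} + |s|^{2H} - |t - s|^{2H}) / 2`. -/
structure IsFractionalBrownianMotion {Ω : Type*} [MeasurableSpace Ω]
    (B : ℝ → Ω → ℝ) (H : ℝ) (P : Measure Ω) : Prop where
  hurst_pos : 0 < H
  hurst_le_one : H ≤ 1
  gaussian : IsGaussianProcess B P
  continuous_paths : ∀ᵐ ω ∂P, Continuous fun t => B t ω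
  centered : ∀ t, ∫ ω, B t ω ∂P = 0
  covariance_eq : ∀ t s, ∫ ω, B t ω * B s ω ∂P
    = (1 / 2) * (|t| ^ (2 * H) + |s| ^ (2 * H) - |t - s| ^ (2 * H))

/-- `I` is the Riemann–Stieltjes integral `∫_a^b f dg` (with `a ≤ b`): the sums
`∑ f(c_i) (g(x_{i+1}) - g(x_i))` over tagged partitions `a = x_0 ≤ x_1 ≤ ⋯ ≤ x_n = b`,
`x_i ≤ c_i ≤ x_{i+1}`, tend to `I` as the mesh tends to `0`. -/
def IsRiemannStieltjesIntegral (f g : ℝ → ℝ) (a b I : ℝ) : Prop :=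
  a ≤ b ∧ ∀ ε > 0, ∃ δ > 0, ∀ (n : ℕ) (x c : ℕ → ℝ), x 0 = a → x n = b →
    (∀ i < n, x i ≤ c i ∧ c i ≤ x (i + 1) ∧ x (i + 1) - x i < δ) →
    |∑ i ∈ Finset.range n, f (c i) * (g (x (i + 1)) - g (x i)) - I| < ε

/-- `I` is the improper Riemann–Stieltjes integral
`∫_{-∞}^b f dg = lim_{a → -∞} ∫_a^b f dg`; all the integrals and the limit exist. -/
def IsImproperRiemannStieltjesIntegral (f g : ℝ → ℝ) (b I : ℝ) : Prop :=
  ∃ J : ℝ → ℝ, (∀ a ≤ b, IsRiemannStieltjesIntegral f g a b (J a)) ∧ Tendsto J atBot (𝓝 I)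

/-- `v` is the value at `t` of the Ornstein–Uhlenbeck operator with parameter `lam` applied to
the path `y`, that is `v = T_lam(y)(t) = ∫_{-∞}^t e^{-lam (t - s)} dy(s)`. -/
def IsOUOperatorValue (lam : ℝ) (y : ℝ → ℝ) (t v : ℝ) : Prop :=
  IsImproperRiemannStieltjesIntegral (fun s => Real.exp (-lam * (t - s))) y t v

/-- `X ∼ FOU(lam, σ, H)`: there is a fractional Brownian motion `B` with Hurst parameter `H` such
that, for every `t`, almost surely `X_t = T_lam(σ B)(t) = σ ∫_{-∞}^t e^{-lam (t - s)} dB(s)`. -/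
structure IsFOU {Ω : Type*} [MeasurableSpace Ω]
    (X : ℝ → Ω → ℝ) (lam σ H : ℝ) (P : Measure Ω) : Prop where
  lam_pos : 0 < lam
  sigma_pos : 0 < σ
  exists_fbm : ∃ B : ℝ → Ω → ℝ, IsFractionalBrownianMotion B H P ∧
    ∀ t, ∀ᵐ ω ∂P, IsOUOperatorValue lam (fun s => σ * B s ω) t (X t ω)

/-- `f_H^{(1)}(x) = e^{-x} (Γ(2H) - ∫_0^x e^s s^{2H-1} ds)`, used for `x ≥ 0`. -/
def fH1 (H x : ℝ) : ℝ :=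
  Real.exp (-x) * (Real.Gamma (2 * H) - ∫ s in (0 : ℝ)..x, Real.exp s * s ^ (2 * H - 1))

/-- `f_H^{(2)}(x) = e^x (Γ(2H) - ∫_0^x e^{-s} s^{2H-1} ds)`, used for `x ≥ 0`. -/
def fH2 (H x : ℝ) : ℝ :=
  Real.exp x * (Real.Gamma (2 * H) - ∫ s in (0 : ℝ)..x, Real.exp (-s) * s ^ (2 * H - 1))

/-- `f_H = f_H^{(1)} + f_H^{(2)}`, used for `x ≥ 0`. -/
def fH (H x : ℝ) : ℝ := fH1 H x + fH2 H x

end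

/-!
Let `Y = σ B`, seen as a curve in `L²` with `‖Y s - Y t‖ ^ 2 = φ (s - t)`, `φ r = σ² |r| ^ (2 * H)`.
Integrating by parts, `X t = Y t - E_U [Y (t - U)]` is the mean of the increments `Y t - Y (t - U)`,
where `U` is exponentially distributed with rate `lam`. Polarization then gives, for an
independent copy `V` of `U` and `r = s - t`,
`2 ⟪X s, X t⟫ = E φ (r + V) + E φ (r - U) - φ r - E φ (r - (U - V))`.
By partial fractions of characteristic functions, `U - V` has the law of `U` or of `-U` with
probability one half each, so that `4 ⟪X s, X t⟫ = E φ (r + U) + E φ (r - U) - 2 φ r`. For the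
standard exponential law and `x ≥ 0`, one more integration by parts turns `E |x + U| ^ (2 * H)` and
`E |x - U| ^ (2 * H)` into `x ^ (2 * H) + 2 * H * fH2 H x` and `x ^ (2 * H) + 2 * H * fH1 H x`.

The pathwise integrals are limits of the same Riemann–Stieltjes sums as the integrals of the curve
`Y`, one almost surely and the other in `L²`; an `L²` limit is an almost sure limit along a
subsequence, so the two agree almost surely.
-/

section ExponentialLaw

open scoped NNReal Measure

variable {l : ℝ}

theorem expMeasure_eq_withDensity (l : ℝ) : expMeasure l =
    (volume.restrict (Set.Ioi 0)).withDensity fun u => ENNReal.ofReal (l * Real.exp (-l * u)) := by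
  have hpdf : exponentialPDF l =
      (Set.Ici 0).indicator fun u => ENNReal.ofReal (l * Real.exp (-l * u)) := by
    ext u
    by_cases hu : 0 ≤ u <;> simp [exponentialPDF_eq, hu]
  rw [restrict_Ioi_eq_restrict_Ici, ← withDensity_indicator measurableSet_Ici, ← hpdf]
  rfl

section Integral

variable {E : Type*} [NormedAddCommGroup E] [NormedSpace ℝ E] {f : ℝ → E}

theorem integrable_expMeasure_iff (hl : 0 < l) : Integrable f (expMeasure l) ↔
    IntegrableOn (fun u => (l * Real.exp (-l * u)) • f u) (Set.Ioi 0) := by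
  rw [expMeasure_eq_withDensity, integrable_withDensity_iff_integrable_smul' (by fun_prop)
    (ae_of_all _ fun _ => ENNReal.ofReal_lt_top)]
  simp only [ENNReal.toReal_ofReal (mul_pos hl (Real.exp_pos _)).le, IntegrableOn]

theorem integral_expMeasure (hl : 0 < l) (f : ℝ → E) : ∫ u, f u ∂expMeasure l =
    ∫ u in Set.Ioi 0, (l * Real.exp (-l * u)) • f u := by
  rw [expMeasure_eq_withDensity, integral_withDensity_eq_integral_toReal_smul (by fun_prop)
    (ae_of_all _ fun _ => ENNReal.ofReal_lt_top)]
  simp only [ENNReal.toReal_ofReal (mul_pos hl (Real.exp_pos _)).le]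

end Integral

theorem charFun_expMeasure (hl : 0 < l) (t : ℝ) :
    charFun (expMeasure l) t = l / (l - t * Complex.I) := by
  have hre : (t * Complex.I - l : ℂ).re < 0 := by simpa using hl
  calc charFun (expMeasure l) t
      = ∫ u in Set.Ioi (0 : ℝ), l * Complex.exp ((t * Complex.I - l) * u) := by
        rw [charFun_apply_real, integral_expMeasure hl]
        refine integral_congr_ae (ae_of_all _ fun u => ?_)
        simp only [Complex.real_smul, Complex.ofReal_mul, Complex.ofReal_exp, mul_assoc,
          ← Complex.exp_add]
        push_cast
        ring_nf
    _ = l / (l - t * Complex.I) := by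
        rw [integral_const_mul, integral_exp_mul_complex_Ioi hre, ← neg_sub, div_neg]
        simp [div_eq_mul_inv]

theorem map_mul_expMeasure (hl : 0 < l) : (expMeasure l).map (l * ·) = expMeasure 1 := by
  have := isProbabilityMeasure_expMeasure hl
  have := isProbabilityMeasure_expMeasure one_pos
  refine Measure.ext_of_charFun (funext fun t => ?_)
  rw [charFun_map_mul, charFun_expMeasure hl, charFun_expMeasure one_pos]
  push_cast
  rw [mul_assoc, ← mul_one_sub, ← div_div, div_self (by exact_mod_cast hl.ne')]

theorem expMeasure_conv_map_neg (hl : 0 < l) :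
    expMeasure l ∗ (expMeasure l).map Neg.neg =
      (2⁻¹ : ℝ≥0) • (expMeasure l + (expMeasure l).map Neg.neg) := by
  have := isProbabilityMeasure_expMeasure hl
  refine Measure.ext_of_charFun (funext fun t => ?_)
  have hneg : charFun ((expMeasure l).map Neg.neg) t = l / (l + t * Complex.I) := by
    simpa [neg_one_mul, charFun_expMeasure hl] using
      charFun_map_mul (μ := expMeasure l) (-1) t
  have hint (ν : Measure ℝ) [IsFiniteMeasure ν] :
      Integrable (fun x : ℝ => Complex.exp (t * x * Complex.I)) ν :=
    (integrable_const (1 : ℝ)).mono' (by fun_prop) (ae_of_all _ fun x => by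
      rw [← Complex.ofReal_mul, Complex.norm_exp_ofReal_mul_I])
  have hsum : charFun ((2⁻¹ : ℝ≥0) • (expMeasure l + (expMeasure l).map Neg.neg)) t =
      2⁻¹ * (charFun (expMeasure l) t + charFun ((expMeasure l).map Neg.neg) t) := by
    simp only [charFun_apply_real]
    rw [integral_smul_nnreal_measure, integral_add_measure (hint _) (hint _)]
    simp [NNReal.smul_def, mul_add]
  have hadd : (l + t * Complex.I : ℂ) ≠ 0 := fun h => hl.ne' (by simpa using congrArg Complex.re h)
  have hsub : (l - t * Complex.I : ℂ) ≠ 0 := fun h => hl.ne' (by simpa using congrArg Complex.re h)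
  rw [hsum, charFun_conv, hneg, charFun_expMeasure hl]
  field_simp
  ring

section Integral

variable {E : Type*} [NormedAddCommGroup E] {f : ℝ → E}

theorem map_sub_expMeasure_prod (hl : 0 < l) :
    ((expMeasure l).prod (expMeasure l)).map (fun q => q.1 - q.2) =
      (2⁻¹ : ℝ≥0) • (expMeasure l + (expMeasure l).map Neg.neg) := by
  have := isProbabilityMeasure_expMeasure hl
  rw [← expMeasure_conv_map_neg hl, Measure.conv, ← Measure.map_id (μ := expMeasure l),
    Measure.map_map measurable_neg measurable_id,
    Measure.map_prod_map _ _ measurable_id (measurable_neg.comp measurable_id),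
    Measure.map_map (by fun_prop) (by fun_prop), Measure.map_id]
  simp [Function.comp_def, sub_eq_add_neg]

theorem integrable_sub_expMeasure_prod (hl : 0 < l) (hf : Integrable f (expMeasure l))
    (hf' : Integrable (fun u => f (-u)) (expMeasure l)) :
    Integrable (fun q : ℝ × ℝ => f (q.1 - q.2)) ((expMeasure l).prod (expMeasure l)) := by
  have hneg := (measurableEmbedding_neg.integrable_map_iff (μ := expMeasure l)).2 hf'
  have := (hf.add_measure hneg).smul_measure_nnreal (c := 2⁻¹)
  rw [← map_sub_expMeasure_prod hl] at this
  exact this.comp_measurable (by fun_prop)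

theorem integral_sub_expMeasure_prod [NormedSpace ℝ E] (hl : 0 < l)
    (hf : Integrable f (expMeasure l)) (hf' : Integrable (fun u => f (-u)) (expMeasure l)) :
    ∫ q : ℝ × ℝ, f (q.1 - q.2) ∂(expMeasure l).prod (expMeasure l) =
      (2⁻¹ : ℝ) • (∫ u, f u ∂expMeasure l + ∫ u, f (-u) ∂expMeasure l) := by
  have hneg := (measurableEmbedding_neg.integrable_map_iff (μ := expMeasure l)).2 hf'
  have hlaw := (hf.add_measure hneg).smul_measure_nnreal (c := 2⁻¹)
  rw [← map_sub_expMeasure_prod hl] at hlaw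
  rw [← integral_map (f := f) (by fun_prop) hlaw.1, map_sub_expMeasure_prod hl,
    integral_smul_nnreal_measure, integral_add_measure hf hneg,
    measurableEmbedding_neg.integral_map]
  simp [NNReal.smul_def]

end Integral

theorem memLp_id_expMeasure (hl : 0 < l) (p : NNReal) : MemLp id p (expMeasure l) := by
  refine memLp_of_mem_interior_integrableExpSet (mem_interior.2
    ⟨Set.Iio l, fun t (ht : t < l) => ?_, isOpen_Iio, hl⟩) p
  refine (integrable_expMeasure_iff hl).2 ?_
  refine ((integrableOn_exp_mul_Ioi (sub_neg.2 ht) 0).const_mul l).congr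
    (ae_of_all _ fun u => ?_)
  simp only [id, smul_eq_mul, mul_assoc, ← Real.exp_add]
  ring_nf

end ExponentialLaw

section ExponentialMoments

variable {l p x : ℝ}

theorem integrable_abs_add_rpow_expMeasure (hl : 0 < l) (hp : 0 ≤ p) (x : ℝ) :
    Integrable (fun u => |x + u| ^ p) (expMeasure l) := by
  have := isProbabilityMeasure_expMeasure hl
  lift p to NNReal using hp
  simpa using ((memLp_const x).add (memLp_id_expMeasure hl p)).integrable_norm_rpow'

theorem integrable_abs_sub_rpow_expMeasure (hl : 0 < l) (hp : 0 ≤ p) (x : ℝ) :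
    Integrable (fun u => |x - u| ^ p) (expMeasure l) := by
  simpa only [neg_add_eq_sub, abs_sub_comm] using integrable_abs_add_rpow_expMeasure hl hp (-x)

theorem integral_comp_add_expMeasure {E : Type*} [NormedAddCommGroup E] [NormedSpace ℝ E]
    {f : ℝ → E} (hl : 0 < l) (hf : Integrable f (expMeasure l))
    (hfx : IntervalIntegrable f volume 0 x) :
    ∫ u, f (x + u) ∂expMeasure l = Real.exp (l * x) •
      (∫ u, f u ∂expMeasure l - ∫ s in (0 : ℝ)..x, (l * Real.exp (-l * s)) • f s) := by
  have hshift : ∫ u in Set.Ioi 0, (l * Real.exp (-l * (x + u))) • f (x + u) =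
      ∫ s in Set.Ioi x, (l * Real.exp (-l * s)) • f s := by
    have := (measurePreserving_add_left volume x).setIntegral_preimage_emb
      (measurableEmbedding_addLeft x) (fun s => (l * Real.exp (-l * s)) • f s) (Set.Ioi x)
    simpa using this
  have hsplit := intervalIntegral.integral_interval_add_Ioi'
    (hfx.symm.continuousOn_smul (f := fun s => l * Real.exp (-l * s)) (by fun_prop))
    ((integrable_expMeasure_iff hl).1 hf)
  rw [intervalIntegral.integral_symm, neg_add_eq_sub] at hsplit
  rw [integral_expMeasure hl, integral_expMeasure hl, hsplit, ← hshift, ← integral_smul]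
  refine integral_congr_ae (ae_of_all _ fun u => ?_)
  simp only [smul_smul, mul_left_comm _ l, ← Real.exp_add]
  ring_nf

theorem integral_abs_rpow_expMeasure_one (hp : -1 < p) :
    ∫ u, |u| ^ p ∂expMeasure 1 = Real.Gamma (p + 1) := by
  rw [integral_expMeasure one_pos, Real.Gamma_eq_integral (by linarith)]
  refine setIntegral_congr_fun measurableSet_Ioi fun u hu => ?_
  simp [abs_of_pos (Set.mem_Ioi.1 hu)]

theorem integral_abs_add_rpow_expMeasure_one (hp : 0 ≤ p) (x : ℝ) :
    ∫ u, |x + u| ^ p ∂expMeasure 1 =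
      Real.exp x * (Real.Gamma (p + 1) - ∫ s in (0 : ℝ)..x, Real.exp (-s) * |s| ^ p) := by
  have hc : Continuous fun u : ℝ => |u| ^ p := continuous_abs.rpow_const fun _ => Or.inr hp
  have hint : Integrable (fun u => |u| ^ p) (expMeasure 1) := by
    simpa using integrable_abs_add_rpow_expMeasure one_pos hp 0
  simpa [integral_abs_rpow_expMeasure_one (p := p) (by linarith)] using
    integral_comp_add_expMeasure one_pos hint (hc.intervalIntegrable 0 x)

theorem integral_exp_mul_rpow (hp : 0 < p) (hx : 0 ≤ x) (k : ℝ) :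
    k * ∫ s in (0 : ℝ)..x, Real.exp (k * s) * s ^ p =
      Real.exp (k * x) * x ^ p - p * ∫ s in (0 : ℝ)..x, Real.exp (k * s) * s ^ (p - 1) := by
  have hexp (s : ℝ) : HasDerivAt (fun s => Real.exp (k * s)) (k * Real.exp (k * s)) s := by
    simpa [mul_comm] using ((hasDerivAt_id s).const_mul k).exp
  have hpow (s : ℝ) (hs : s ∈ Set.Ioo (min 0 x) (max 0 x)) :
      HasDerivAt (fun s : ℝ => s ^ p) (p * s ^ (p - 1)) s :=
    Real.hasDerivAt_rpow_const (Or.inl (by simpa [hx] using hs.1 |>.ne'))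
  have hparts := intervalIntegral.integral_mul_deriv_eq_deriv_mul_of_hasDerivAt (a := 0) (b := x)
    (by fun_prop) (continuousOn_id.rpow_const fun _ _ => Or.inr hp.le) (fun s _ => hexp s) hpow
    (by apply Continuous.intervalIntegrable; fun_prop)
    ((intervalIntegral.intervalIntegrable_rpow' (by linarith)).const_mul p)
  simp only [Real.zero_rpow hp.ne', mul_left_comm _ p, mul_assoc k, id,
    intervalIntegral.integral_const_mul] at hparts
  linarith

theorem integral_abs_add_rpow_expMeasure_one_eq_fH2 {H : ℝ} (hH : 0 < H) (hx : 0 ≤ x) :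
    ∫ u, |x + u| ^ (2 * H) ∂expMeasure 1 = x ^ (2 * H) + 2 * H * fH2 H x := by
  have hparts := integral_exp_mul_rpow (p := 2 * H) (by positivity) hx (-1)
  have habs : ∫ s in (0 : ℝ)..x, Real.exp (-s) * |s| ^ (2 * H) =
      ∫ s in (0 : ℝ)..x, Real.exp (-s) * s ^ (2 * H) :=
    intervalIntegral.integral_congr fun s hs => by
      simp only [abs_of_nonneg (Set.uIcc_of_le hx ▸ hs).1]
  rw [integral_abs_add_rpow_expMeasure_one (by positivity), Real.Gamma_add_one (by positivity),
    habs, fH2]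
  simp only [neg_one_mul] at hparts
  have hexp : Real.exp x * Real.exp (-x) = 1 := by rw [← Real.exp_add]; simp
  linear_combination Real.exp x * hparts + x ^ (2 * H) * hexp

theorem integral_abs_sub_rpow_expMeasure_one_eq_fH1 {H : ℝ} (hH : 0 < H) (hx : 0 ≤ x) :
    ∫ u, |x - u| ^ (2 * H) ∂expMeasure 1 = x ^ (2 * H) + 2 * H * fH1 H x := by
  have hparts := integral_exp_mul_rpow (p := 2 * H) (by positivity) hx 1
  have habs : ∫ s in (0 : ℝ)..-x, Real.exp (-s) * |s| ^ (2 * H) =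
      -∫ s in (0 : ℝ)..x, Real.exp s * s ^ (2 * H) := by
    have hneg := intervalIntegral.integral_comp_neg (a := x) (b := 0)
      fun s => Real.exp (-s) * |s| ^ (2 * H)
    rw [neg_zero] at hneg
    rw [← hneg, intervalIntegral.integral_symm, neg_inj]
    refine intervalIntegral.integral_congr fun s hs => ?_
    simp only [neg_neg, abs_neg, abs_of_nonneg (Set.uIcc_of_le hx ▸ hs).1]
  have := integral_abs_add_rpow_expMeasure_one (p := 2 * H) (by positivity) (-x)
  simp only [neg_add_eq_sub, abs_sub_comm _ x] at this
  rw [this, Real.Gamma_add_one (by positivity), habs, fH1]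
  simp only [one_mul] at hparts
  have hexp : Real.exp (-x) * Real.exp x = 1 := by rw [← Real.exp_add]; simp
  linear_combination Real.exp (-x) * hparts + x ^ (2 * H) * hexp

theorem integral_abs_add_rpow_expMeasure (hl : 0 < l) (p x : ℝ) :
    ∫ u, |x + u| ^ p ∂expMeasure l = (∫ u, |l * x + u| ^ p ∂expMeasure 1) / l ^ p := by
  rw [← map_mul_expMeasure hl, (measurableEmbedding_mulLeft₀ hl.ne').integral_map,
    ← integral_div]
  refine integral_congr_ae (ae_of_all _ fun u => ?_)
  beta_reduce
  rw [← mul_add, abs_mul, abs_of_pos hl, Real.mul_rpow hl.le (abs_nonneg _)]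
  field_simp

theorem integral_abs_add_rpow_add_integral_abs_sub_rpow {H : ℝ} (hl : 0 < l) (hH : 0 < H) (r : ℝ) :
    ∫ u, |r + u| ^ (2 * H) ∂expMeasure l + ∫ u, |r - u| ^ (2 * H) ∂expMeasure l =
      2 * |r| ^ (2 * H) + 2 * H * fH H (l * |r|) / l ^ (2 * H) := by
  wlog hr : 0 ≤ r generalizing r
  · have := this (-r) (by linarith)
    rw [abs_neg] at this
    rw [← this, add_comm]
    congr 2
    · simp only [neg_add_eq_sub, abs_sub_comm]
    · simp only [← neg_add', abs_neg]
  have hsub : ∫ u, |r - u| ^ (2 * H) ∂expMeasure l =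
      (∫ u, |l * r - u| ^ (2 * H) ∂expMeasure 1) / l ^ (2 * H) := by
    have := integral_abs_add_rpow_expMeasure hl (2 * H) (-r)
    simpa only [mul_neg, neg_add_eq_sub, abs_sub_comm] using this
  rw [integral_abs_add_rpow_expMeasure hl, hsub,
    integral_abs_add_rpow_expMeasure_one_eq_fH2 hH (by positivity),
    integral_abs_sub_rpow_expMeasure_one_eq_fH1 hH (by positivity), abs_of_nonneg hr,
    Real.mul_rpow hl.le hr, fH]
  field_simp
  ring

end ExponentialMoments

section RiemannStieltjesSums

variable {E : Type*} [NormedAddCommGroup E] [NormedSpace ℝ E] {f f' : ℝ → ℝ} {b : ℝ → E} {a c : ℝ}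

/-- The `i`-th point of the partition of `[a, c]` into `m + 1` intervals of equal length; it
belongs to `[a, c]` for `i ≤ m + 1`. -/
noncomputable def uniformNode (a c : ℝ) (m i : ℕ) : ℝ := a + i * ((c - a) / (m + 1))

/-- The Riemann–Stieltjes sum of `∫_a^c f db` over the partition of `[a, c]` into `m + 1` intervals
of equal length, with tags at the right endpoints. The integrator `b` is vector-valued, which covers
both the paths of a process and the process seen as a curve in `L^p`. -/
noncomputable def rightStieltjesSum (f : ℝ → ℝ) (b : ℝ → E) (a c : ℝ) (m : ℕ) : E :=
  ∑ i ∈ Finset.range (m + 1), f (uniformNode a c m (i + 1)) •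
    (b (uniformNode a c m (i + 1)) - b (uniformNode a c m i))

@[simp]
theorem uniformNode_zero (a c : ℝ) (m : ℕ) : uniformNode a c m 0 = a := by simp [uniformNode]

@[simp]
theorem uniformNode_last (a c : ℝ) (m : ℕ) : uniformNode a c m (m + 1) = c := by
  simp only [uniformNode]
  push_cast
  field_simp
  ring

theorem uniformNode_succ_sub (a c : ℝ) (m i : ℕ) :
    uniformNode a c m (i + 1) - uniformNode a c m i = (c - a) / (m + 1) := by
  simp only [uniformNode]
  push_cast
  ring

theorem monotone_uniformNode (hac : a ≤ c) (m : ℕ) : Monotone (uniformNode a c m) :=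
  monotone_nat_of_le_succ fun i => by
    have : 0 ≤ (c - a) / (m + 1) := div_nonneg (sub_nonneg.2 hac) (by positivity)
    linarith [uniformNode_succ_sub a c m i]

theorem uniformNode_mem_Icc (hac : a ≤ c) {m i : ℕ} (hi : i ≤ m + 1) :
    uniformNode a c m i ∈ Set.Icc a c :=
  ⟨by simpa using monotone_uniformNode hac m i.zero_le,
    by simpa using monotone_uniformNode hac m hi⟩

theorem uIcc_uniformNode_subset_Icc (hac : a ≤ c) {m i : ℕ} (hi : i < m + 1) :
    Set.uIcc (uniformNode a c m i) (uniformNode a c m (i + 1)) ⊆ Set.Icc a c :=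
  Set.uIcc_subset_Icc (uniformNode_mem_Icc hac hi.le) (uniformNode_mem_Icc hac hi)

theorem tendsto_uniformNode_mesh (a c : ℝ) :
    Tendsto (fun m : ℕ => (c - a) / ((m : ℝ) + 1)) atTop (𝓝 0) :=
  tendsto_const_nhds.div_atTop (tendsto_natCast_atTop_atTop.atTop_add tendsto_const_nhds)

theorem IsRiemannStieltjesIntegral.tendsto_rightStieltjesSum {g : ℝ → ℝ} {I : ℝ}
    (h : IsRiemannStieltjesIntegral f g a c I) :
    Tendsto (rightStieltjesSum f g a c) atTop (𝓝 I) := by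
  obtain ⟨hac, h⟩ := h
  refine Metric.tendsto_nhds.2 fun ε hε => ?_
  obtain ⟨δ, hδ, hI⟩ := h ε hε
  filter_upwards [(tendsto_uniformNode_mesh a c).eventually (gt_mem_nhds hδ)] with m hm
  refine hI (m + 1) (uniformNode a c m) (fun i => uniformNode a c m (i + 1)) (by simp) (by simp)
    fun i _ => ⟨monotone_uniformNode hac m i.le_succ, le_rfl, ?_⟩
  rwa [uniformNode_succ_sub]

theorem rightStieltjesSum_sub_integral_by_parts [CompleteSpace E] (hac : a ≤ c)
    (hf : ∀ s ∈ Set.Icc a c, HasDerivAt f (f' s) s) (hf' : ContinuousOn f' (Set.Icc a c))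
    (hb : ContinuousOn b (Set.Icc a c)) (m : ℕ) :
    rightStieltjesSum f b a c m - (f c • b c - f a • b a - ∫ s in a..c, f' s • b s) =
      ∑ i ∈ Finset.range (m + 1), ∫ s in uniformNode a c m i..uniformNode a c m (i + 1),
        f' s • (b s - b (uniformNode a c m i)) := by
  set x := uniformNode a c m
  have hfirst : x 0 = a := uniformNode_zero a c m
  have hlast : x (m + 1) = c := uniformNode_last a c m
  have hint {g : ℝ → E} (hg : ContinuousOn g (Set.Icc a c)) (i : ℕ) (hi : i < m + 1) :
      IntervalIntegrable (fun s => f' s • g s) volume (x i) (x (i + 1)) :=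
    ((hf'.smul hg).mono (uIcc_uniformNode_subset_Icc hac hi)).intervalIntegrable
  have hterm (i : ℕ) (hi : i ∈ Finset.range (m + 1)) :
      ∫ s in x i..x (i + 1), f' s • (b s - b (x i)) =
        f (x (i + 1)) • (b (x (i + 1)) - b (x i)) -
          (f (x (i + 1)) • b (x (i + 1)) - f (x i) • b (x i)) +
          ∫ s in x i..x (i + 1), f' s • b s := by
    have hi := Finset.mem_range.1 hi
    have hsub := uIcc_uniformNode_subset_Icc hac hi
    simp only [smul_sub]
    rw [intervalIntegral.integral_sub (hint hb i hi) (hint continuousOn_const i hi),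
      intervalIntegral.integral_smul_const, intervalIntegral.integral_eq_sub_of_hasDerivAt
        (fun s hs => hf s (hsub hs)) (hf'.mono hsub).intervalIntegrable]
    module
  have htelescope := Finset.sum_range_sub (fun i => f (x i) • b (x i)) (m + 1)
  have hadjacent := intervalIntegral.sum_integral_adjacent_intervals (hint hb)
  rw [hfirst, hlast] at htelescope hadjacent
  rw [Finset.sum_congr rfl hterm, Finset.sum_add_distrib, Finset.sum_sub_distrib, htelescope,
    hadjacent, rightStieltjesSum]
  abel

theorem norm_rightStieltjesSum_sub_integral_by_parts_le [CompleteSpace E] {M ε : ℝ} {m : ℕ}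
    (hac : a ≤ c) (hf : ∀ s ∈ Set.Icc a c, HasDerivAt f (f' s) s)
    (hf' : ContinuousOn f' (Set.Icc a c)) (hM : ∀ s ∈ Set.Icc a c, ‖f' s‖ ≤ M)
    (hb : ContinuousOn b (Set.Icc a c)) (hε : ∀ s ∈ Set.Icc a c, ∀ r ∈ Set.Icc a c,
      dist s r ≤ (c - a) / (m + 1) → dist (b s) (b r) ≤ ε) :
    ‖rightStieltjesSum f b a c m - (f c • b c - f a • b a - ∫ s in a..c, f' s • b s)‖ ≤
      M * ε * (c - a) := by
  set d := (c - a) / (m + 1) with hd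
  have hterm (i : ℕ) (hi : i ∈ Finset.range (m + 1)) :
      ‖∫ s in uniformNode a c m i..uniformNode a c m (i + 1),
        f' s • (b s - b (uniformNode a c m i))‖ ≤ M * ε * d := by
    have hi := Finset.mem_range.1 hi
    have hle := monotone_uniformNode hac m i.le_succ
    have hlen := uniformNode_succ_sub a c m i
    rw [← hd] at hlen
    refine (intervalIntegral.norm_integral_le_of_norm_le_const (C := M * ε) fun s hs => ?_).trans_eq
      (by rw [hlen, abs_of_nonneg (by linarith)])
    have hs' := uIcc_uniformNode_subset_Icc hac hi (Set.uIoc_subset_uIcc hs)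
    rw [Set.uIoc_of_le hle] at hs
    have hdist : dist s (uniformNode a c m i) ≤ d := by
      rw [Real.dist_eq, abs_of_pos (sub_pos.2 hs.1)]
      linarith [hs.2]
    rw [norm_smul, ← dist_eq_norm]
    exact mul_le_mul (hM s hs') (hε s hs' _ (uniformNode_mem_Icc hac hi.le) hdist) dist_nonneg
      ((norm_nonneg _).trans (hM s hs'))
  rw [rightStieltjesSum_sub_integral_by_parts hac hf hf' hb]
  refine (norm_sum_le_of_le _ hterm).trans_eq ?_
  rw [Finset.sum_const, Finset.card_range, nsmul_eq_mul, hd]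
  push_cast
  field_simp

theorem tendsto_rightStieltjesSum [CompleteSpace E] (hac : a ≤ c)
    (hf : ∀ s ∈ Set.Icc a c, HasDerivAt f (f' s) s) (hf' : ContinuousOn f' (Set.Icc a c))
    (hb : ContinuousOn b (Set.Icc a c)) :
    Tendsto (rightStieltjesSum f b a c) atTop
      (𝓝 (f c • b c - f a • b a - ∫ s in a..c, f' s • b s)) := by
  obtain ⟨M, hM⟩ := isCompact_Icc.exists_bound_of_continuousOn hf'
  have hM0 : 0 ≤ M := (norm_nonneg _).trans (hM a (Set.left_mem_Icc.2 hac))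
  have hscale : 0 < M * (c - a) + 1 := by nlinarith
  refine Metric.tendsto_nhds.2 fun ε hε => ?_
  obtain ⟨δ, hδ, hbδ⟩ := Metric.uniformContinuousOn_iff.1
    (isCompact_Icc.uniformContinuousOn_of_continuous hb) (ε / (M * (c - a) + 1)) (by positivity)
  filter_upwards [(tendsto_uniformNode_mesh a c).eventually (gt_mem_nhds hδ)] with m hm
  rw [dist_eq_norm]
  calc _ ≤ M * (ε / (M * (c - a) + 1)) * (c - a) :=
        norm_rightStieltjesSum_sub_integral_by_parts_le hac hf hf' hM hb
          fun s hs r hr hsr => (hbδ s hs r hr (hsr.trans_lt hm)).le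
    _ < ε := by
        field_simp
        nlinarith

end RiemannStieltjesSums

theorem integrable_comp_sub_expMeasure_of_holderWith {E : Type*} [NormedAddCommGroup E] {b : ℝ → E}
    {C r : NNReal} {l : ℝ} (hl : 0 < l) (hr : 0 < r) (hb : HolderWith C r b) (t : ℝ) :
    Integrable (fun u => b (t - u)) (expMeasure l) := by
  have := isProbabilityMeasure_expMeasure hl
  have hbc := hb.continuous hr
  have hpow := integrable_abs_sub_rpow_expMeasure hl r.coe_nonneg 0
  refine ((integrable_const ‖b t‖).add (hpow.const_mul C)).mono' (by fun_prop)
    (ae_of_all _ fun u => ?_)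
  have hdist := hb.dist_le (t - u) t
  rw [dist_eq_norm, Real.dist_eq, sub_sub_cancel_left, ← zero_sub] at hdist
  exact (norm_le_norm_add_norm_sub' _ _).trans (add_le_add le_rfl hdist)

section OrnsteinUhlenbeckOperator

variable {E F : Type*} [NormedAddCommGroup E] [NormedSpace ℝ E] [NormedAddCommGroup F]
  [NormedSpace ℝ F] {l a t : ℝ} {b : ℝ → E}

/-- The integral `∫_a^t e^{-l (t - s)} db(s)` of a vector-valued curve `b`, encoded by the result of
an integration by parts, which only involves the values of `b`. -/
noncomputable def ouIntegral (l : ℝ) (b : ℝ → E) (a t : ℝ) : E :=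
  b t - Real.exp (-l * (t - a)) • b a - ∫ s in a..t, (l * Real.exp (-l * (t - s))) • b s

/-- The Ornstein–Uhlenbeck operator `∫_{-∞}^t e^{-l (t - s)} db(s)` applied to a vector-valued
curve `b`, encoded by the result of an integration by parts: `b t` minus the mean of `b` at an
exponentially distributed time before `t`. -/
noncomputable def ouOperator (l : ℝ) (b : ℝ → E) (t : ℝ) : E :=
  b t - ∫ u, b (t - u) ∂expMeasure l

theorem tendsto_rightStieltjesSum_ouIntegral [CompleteSpace E] (l : ℝ) (hat : a ≤ t)
    (hb : ContinuousOn b (Set.Icc a t)) :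
    Tendsto (rightStieltjesSum (fun s => Real.exp (-l * (t - s))) b a t) atTop
      (𝓝 (ouIntegral l b a t)) := by
  have hderiv (s : ℝ) :
      HasDerivAt (fun s => Real.exp (-l * (t - s))) (l * Real.exp (-l * (t - s))) s := by
    simpa [mul_comm] using (((hasDerivAt_id s).const_sub t).const_mul (-l)).exp
  simpa [ouIntegral] using
    tendsto_rightStieltjesSum hat (fun s _ => hderiv s) (by fun_prop) hb

theorem tendsto_ouIntegral_atBot (hl : 0 < l)
    (hint : Integrable (fun u => b (t - u)) (expMeasure l))
    (hdecay : Tendsto (fun a => Real.exp (-l * (t - a)) • b a) atBot (𝓝 0)) :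
    Tendsto (fun a => ouIntegral l b a t) atBot (𝓝 (ouOperator l b t)) := by
  have hwindow := intervalIntegral_tendsto_integral_Ioi 0 ((integrable_expMeasure_iff hl).1 hint)
    (tendsto_const_nhds.add_atTop tendsto_neg_atBot_atTop : Tendsto (t + -·) atBot atTop)
  have hflip (a : ℝ) : ∫ u in (0 : ℝ)..t + -a, (l * Real.exp (-l * u)) • b (t - u) =
      ∫ s in a..t, (l * Real.exp (-l * (t - s))) • b s := by
    simpa [← sub_eq_add_neg] using intervalIntegral.integral_comp_sub_left (a := 0) (b := t - a)
      (fun s => (l * Real.exp (-l * (t - s))) • b s) t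
  simp only [hflip, ← integral_expMeasure hl] at hwindow
  simpa [ouIntegral, ouOperator] using (tendsto_const_nhds.sub hdecay).sub hwindow

theorem ouOperator_eq_integral_sub [CompleteSpace E] (hl : 0 < l)
    (hint : Integrable (fun u => b (t - u)) (expMeasure l)) :
    ouOperator l b t = ∫ u, (b t - b (t - u)) ∂expMeasure l := by
  have := isProbabilityMeasure_expMeasure hl
  rw [integral_sub (integrable_const _) hint]
  simp [ouOperator]

theorem map_ouOperator [CompleteSpace E] [CompleteSpace F] (L : E →L[ℝ] F)
    (hint : Integrable (fun u => b (t - u)) (expMeasure l)) :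
    L (ouOperator l b t) = ouOperator l (fun s => L (b s)) t := by
  rw [ouOperator, map_sub, ← L.integral_comp_comm hint, ouOperator]

theorem tendsto_exp_smul_atBot_zero_of_holderWith {C r : NNReal} (hl : 0 < l)
    (hb : HolderWith C r b) (t : ℝ) :
    Tendsto (fun a => Real.exp (-l * (t - a)) • b a) atBot (𝓝 0) := by
  have hdom := ((tendsto_rpow_mul_exp_neg_mul_atTop_nhds_zero 0 l hl).const_mul ‖b t‖).add
    ((tendsto_rpow_mul_exp_neg_mul_atTop_nhds_zero r l hl).const_mul (C : ℝ))
  simp only [Real.rpow_zero, one_mul, mul_zero, add_zero] at hdom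
  have hlag : Tendsto (fun a => t - a) atBot atTop :=
    (tendsto_const_nhds.add_atTop tendsto_neg_atBot_atTop : Tendsto (t + -·) atBot atTop)
  refine squeeze_zero_norm' ?_ (hdom.comp hlag)
  filter_upwards [eventually_le_atBot t] with a ha
  have hdist := hb.dist_le a t
  rw [dist_eq_norm, dist_comm, Real.dist_eq, abs_of_nonneg (sub_nonneg.2 ha)] at hdist
  rw [norm_smul, Real.norm_eq_abs, Real.abs_exp, Function.comp]
  calc Real.exp (-l * (t - a)) * ‖b a‖
      ≤ Real.exp (-l * (t - a)) * (‖b t‖ + C * (t - a) ^ (r : ℝ)) := by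
        gcongr
        exact (norm_le_norm_add_norm_sub' _ _).trans (by gcongr)
    _ = _ := by ring

end OrnsteinUhlenbeckOperator

section Covariance

variable {E : Type*} [NormedAddCommGroup E] [InnerProductSpace ℝ E] {l : ℝ}
  {b : ℝ → E}

theorem two_mul_inner_sub_sub (a b c d : E) :
    2 * inner ℝ (a - b) (c - d) = ‖a - d‖ ^ 2 + ‖b - c‖ ^ 2 - ‖a - c‖ ^ 2 - ‖b - d‖ ^ 2 := by
  simp only [norm_sub_sq_real, inner_sub_left, inner_sub_right]
  ring

theorem inner_ouOperator_eq_integral_prod [CompleteSpace E] (hl : 0 < l)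
    (hint : ∀ t, Integrable (fun u => b (t - u)) (expMeasure l)) (s t : ℝ) :
    inner ℝ (ouOperator l b s) (ouOperator l b t) =
      ∫ q : ℝ × ℝ, inner ℝ (b s - b (s - q.1)) (b t - b (t - q.2))
        ∂(expMeasure l).prod (expMeasure l) := by
  have := isProbabilityMeasure_expMeasure hl
  have hincr (t : ℝ) : Integrable (fun u => b t - b (t - u)) (expMeasure l) :=
    (integrable_const _).sub (hint t)
  rw [ouOperator_eq_integral_sub hl (hint s), ouOperator_eq_integral_sub hl (hint t)]
  exact (integral_prod_bilin (innerSL ℝ) (hincr s) (hincr t)).symm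

theorem four_mul_inner_ouOperator [CompleteSpace E] {φ : ℝ → ℝ} (hl : 0 < l)
    (hb : ∀ s t, ‖b s - b t‖ ^ 2 = φ (s - t))
    (hint : ∀ t, Integrable (fun u => b (t - u)) (expMeasure l))
    (hadd : ∀ r, Integrable (fun u => φ (r + u)) (expMeasure l))
    (hsub : ∀ r, Integrable (fun u => φ (r - u)) (expMeasure l)) (s t : ℝ) :
    4 * inner ℝ (ouOperator l b s) (ouOperator l b t) =
      ∫ u, φ (s - t + u) ∂expMeasure l + ∫ u, φ (s - t - u) ∂expMeasure l - 2 * φ (s - t) := by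
  have := isProbabilityMeasure_expMeasure hl
  set μ := expMeasure l
  set r := s - t
  have hpolar (q : ℝ × ℝ) : 2 * inner ℝ (b s - b (s - q.1)) (b t - b (t - q.2)) =
      φ (r + q.2) + φ (r - q.1) - φ r - φ (r - (q.1 - q.2)) := by
    rw [two_mul_inner_sub_sub, hb, hb, hb, hb]
    simp only [r]
    ring_nf
  have hsnd : Integrable (fun q : ℝ × ℝ => φ (r + q.2)) (μ.prod μ) := (hadd r).comp_snd μ
  have hfst : Integrable (fun q : ℝ × ℝ => φ (r - q.1)) (μ.prod μ) := (hsub r).comp_fst μ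
  have hpair : Integrable (fun q : ℝ × ℝ => φ (r + q.2) + φ (r - q.1)) (μ.prod μ) := hsnd.add hfst
  have hcentered : Integrable (fun q : ℝ × ℝ => φ (r + q.2) + φ (r - q.1) - φ r) (μ.prod μ) :=
    hpair.sub (integrable_const _)
  have hneg : Integrable (fun u => φ (r - -u)) μ := by simpa only [sub_neg_eq_add] using hadd r
  have hdiff := integrable_sub_expMeasure_prod (f := fun w => φ (r - w)) hl (hsub r) hneg
  have hlaplace : ∫ q : ℝ × ℝ, φ (r - (q.1 - q.2)) ∂μ.prod μ =
      2⁻¹ * (∫ u, φ (r - u) ∂μ + ∫ u, φ (r + u) ∂μ) := by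
    simpa using integral_sub_expMeasure_prod (f := fun w => φ (r - w)) hl (hsub r) hneg
  have htwo : 2 * inner ℝ (ouOperator l b s) (ouOperator l b t) =
      ∫ u, φ (r + u) ∂μ + ∫ u, φ (r - u) ∂μ - φ r - ∫ q : ℝ × ℝ, φ (r - (q.1 - q.2)) ∂μ.prod μ := by
    rw [inner_ouOperator_eq_integral_prod hl hint, ← integral_const_mul]
    simp only [hpolar]
    rw [integral_sub hcentered hdiff, integral_sub hpair (integrable_const _),
      integral_add hsnd hfst]
    simp [integral_fun_fst (fun u => φ (r - u)), integral_fun_snd (fun u => φ (r + u))]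
  linarith

end Covariance

section FractionalCurve

variable {E : Type*} [NormedAddCommGroup E] {b : ℝ → E} {l σ H : ℝ}

/-- A curve in a normed space whose increments have norm `σ |s - t| ^ H`. A process with stationary
increments of variance `σ ^ 2 |s - t| ^ (2 * H)` is such a curve in `L²`. -/
def IsFractionalCurve (b : ℝ → E) (σ H : ℝ) : Prop :=
  ∀ s t, ‖b s - b t‖ = σ * |s - t| ^ H

namespace IsFractionalCurve

theorem scale_nonneg (h : IsFractionalCurve b σ H) : 0 ≤ σ := by
  have hunit := h 1 0
  rw [sub_zero, abs_one, Real.one_rpow, mul_one] at hunit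
  exact hunit ▸ norm_nonneg _

theorem holderWith (h : IsFractionalCurve b σ H) (hH : 0 ≤ H) :
    HolderWith σ.toNNReal H.toNNReal b := fun s t => by
  rw [edist_dist, edist_dist, dist_eq_norm, h s t, ENNReal.ofReal_mul h.scale_nonneg, Real.dist_eq,
    Real.coe_toNNReal H hH, ENNReal.ofReal_rpow_of_nonneg (abs_nonneg _) hH]
  rfl

theorem integrable_comp_sub_expMeasure (h : IsFractionalCurve b σ H) (hH : 0 < H)
    (hl : 0 < l) (t : ℝ) : Integrable (fun u => b (t - u)) (expMeasure l) :=
  integrable_comp_sub_expMeasure_of_holderWith hl (Real.toNNReal_pos.2 hH) (h.holderWith hH.le) t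

theorem tendsto_ouIntegral_atBot [NormedSpace ℝ E] (h : IsFractionalCurve b σ H) (hH : 0 < H)
    (hl : 0 < l) (t : ℝ) : Tendsto (fun a => ouIntegral l b a t) atBot (𝓝 (ouOperator l b t)) :=
  _root_.tendsto_ouIntegral_atBot hl (h.integrable_comp_sub_expMeasure hH hl t)
    (tendsto_exp_smul_atBot_zero_of_holderWith hl (h.holderWith hH.le) t)

theorem inner_ouOperator [InnerProductSpace ℝ E] [CompleteSpace E] (h : IsFractionalCurve b σ H)
    (hH : 0 < H) (hl : 0 < l) (s t : ℝ) :
    inner ℝ (ouOperator l b s) (ouOperator l b t) =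
      σ ^ 2 * H * fH H (l * |s - t|) / (2 * l ^ (2 * H)) := by
  have hsq (s t : ℝ) : ‖b s - b t‖ ^ 2 = σ ^ 2 * |s - t| ^ (2 * H) := by
    rw [h s t, mul_pow, ← Real.rpow_mul_natCast (abs_nonneg _), mul_comm H]
    norm_num
  have hfour := four_mul_inner_ouOperator (φ := fun r => σ ^ 2 * |r| ^ (2 * H)) hl hsq
    (h.integrable_comp_sub_expMeasure hH hl)
    (fun r => (integrable_abs_add_rpow_expMeasure hl (by positivity) r).const_mul _)
    (fun r => (integrable_abs_sub_rpow_expMeasure hl (by positivity) r).const_mul _) s t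
  have hmoments := integral_abs_add_rpow_add_integral_abs_sub_rpow hl hH (s - t)
  simp only [integral_const_mul] at hfour
  rw [← mul_add, hmoments] at hfour
  field_simp at hfour ⊢
  linarith

end IsFractionalCurve

end FractionalCurve

section LpCurve

variable {Ω E : Type*} [MeasurableSpace Ω] {P : Measure Ω} [NormedAddCommGroup E] {p : ENNReal}

/-- A process with `L^p` marginals, seen as a curve in `L^p`. -/
noncomputable def lpCurve {Y : ℝ → Ω → E} (hY : ∀ s, MemLp (Y s) p P) (s : ℝ) : Lp E p P :=
  (hY s).toLp (Y s)

theorem coeFn_lpCurve {Y : ℝ → Ω → E} (hY : ∀ s, MemLp (Y s) p P) (s : ℝ) :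
    lpCurve hY s =ᵐ[P] Y s :=
  (hY s).coeFn_toLp

theorem coeFn_rightStieltjesSum_lpCurve [NormedSpace ℝ E] [Fact (1 ≤ p)] {Y : ℝ → Ω → E}
    (hY : ∀ s, MemLp (Y s) p P) (f : ℝ → ℝ) (a c : ℝ) (m : ℕ) :
    ∀ᵐ ω ∂P, (rightStieltjesSum f (lpCurve hY) a c m : Lp E p P) ω =
      rightStieltjesSum f (fun s => Y s ω) a c m := by
  have hterm (k y z : ℝ) : ∀ᵐ ω ∂P,
      (k • (lpCurve hY y - lpCurve hY z) : Lp E p P) ω = k • (Y y ω - Y z ω) :=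
    (((hY y).sub (hY z)).const_smul k).coeFn_toLp
  refine (Lp.coeFn_fun_finsetSum _ _).trans ?_
  filter_upwards [ae_all_iff.2 fun i : ℕ => hterm (f (uniformNode a c m (i + 1)))
    (uniformNode a c m (i + 1)) (uniformNode a c m i)] with ω hω
  exact Finset.sum_congr rfl fun i _ => hω i

theorem ae_eq_of_tendsto_Lp [Fact (1 ≤ p)] {F : ℕ → Lp E p P} {G : Lp E p P}
    (h : Tendsto F atTop (𝓝 G)) :
    ∀ᵐ ω ∂P, ∀ y, Tendsto (fun n => F n ω) atTop (𝓝 y) → y = G ω := by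
  obtain ⟨ns, hns, hlim⟩ := (tendstoInMeasure_of_tendsto_Lp h).exists_seq_tendsto_ae
  filter_upwards [hlim] with ω hω y hy
  exact tendsto_nhds_unique (hy.comp hns.tendsto_atTop) hω

theorem ae_eq_ouIntegral_of_isRiemannStieltjesIntegral [Fact (1 ≤ p)] {Y : ℝ → Ω → ℝ} {l a t : ℝ}
    (hY : ∀ s, MemLp (Y s) p P) (hat : a ≤ t) (hcont : ContinuousOn (lpCurve hY) (Set.Icc a t)) :
    ∀ᵐ ω ∂P, ∀ J, IsRiemannStieltjesIntegral (fun s => Real.exp (-l * (t - s)))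
      (fun s => Y s ω) a t J → J = ouIntegral l (lpCurve hY) a t ω := by
  filter_upwards [ae_eq_of_tendsto_Lp (tendsto_rightStieltjesSum_ouIntegral l hat hcont),
    ae_all_iff.2 (coeFn_rightStieltjesSum_lpCurve hY (fun s => Real.exp (-l * (t - s))) a t)]
    with ω hlim hsum J hJ
  exact hlim J (hJ.tendsto_rightStieltjesSum.congr fun m => (hsum m).symm)

theorem ae_eq_ouOperator_of_isOUOperatorValue [Fact (1 ≤ p)] {Y : ℝ → Ω → ℝ} {x : Ω → ℝ} {l t : ℝ}
    (hY : ∀ s, MemLp (Y s) p P) (hcont : Continuous (lpCurve hY))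
    (hlim : Tendsto (fun a => ouIntegral l (lpCurve hY) a t) atBot
      (𝓝 (ouOperator l (lpCurve hY) t)))
    (hx : ∀ᵐ ω ∂P, IsOUOperatorValue l (fun s => Y s ω) t (x ω)) :
    x =ᵐ[P] (ouOperator l (lpCurve hY) t : Lp ℝ p P) := by
  have hstart : Tendsto (fun n : ℕ => t - n) atTop atBot :=
    tendsto_atBot_add_const_left _ t (tendsto_neg_atTop_atBot.comp tendsto_natCast_atTop_atTop)
  have hle (n : ℕ) : t - n ≤ t := sub_le_self t n.cast_nonneg
  filter_upwards [hx, ae_eq_of_tendsto_Lp (hlim.comp hstart), ae_all_iff.2 fun n : ℕ =>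
    ae_eq_ouIntegral_of_isRiemannStieltjesIntegral (l := l) hY (hle n) hcont.continuousOn]
    with ω ⟨J, hJ, hJlim⟩ huniq hpath
  exact huniq _ ((hJlim.comp hstart).congr fun n => hpath n _ (hJ _ (hle n)))

theorem inner_eq_integral_mul (f g : Lp ℝ 2 P) : inner ℝ f g = ∫ ω, f ω * g ω ∂P := by
  simp only [L2.inner_def, RCLike.inner_apply, conj_trivial, mul_comm]

theorem inner_lpCurve {Y : ℝ → Ω → ℝ} (hY : ∀ s, MemLp (Y s) 2 P) (s t : ℝ) :
    inner ℝ (lpCurve hY s) (lpCurve hY t) = ∫ ω, Y s ω * Y t ω ∂P := by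
  rw [inner_eq_integral_mul]
  exact integral_congr_ae ((coeFn_lpCurve hY s).mul (coeFn_lpCurve hY t))

theorem integral_ouOperator_lpCurve [IsFiniteMeasure P] {Y : ℝ → Ω → ℝ} {l t : ℝ}
    (hY : ∀ s, MemLp (Y s) 2 P) (hmean : ∀ s, ∫ ω, Y s ω ∂P = 0)
    (hint : Integrable (fun u => lpCurve hY (t - u)) (expMeasure l)) :
    ∫ ω, ouOperator l (lpCurve hY) t ω ∂P = 0 := by
  set L := innerSL ℝ (indicatorConstLp 2 MeasurableSet.univ (measure_ne_top P _) (1 : ℝ))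
  have hL (f : Lp ℝ 2 P) : L f = ∫ ω, f ω ∂P := by
    rw [innerSL_apply_apply, L2.inner_indicatorConstLp_one, setIntegral_univ]
  rw [← hL, map_ouOperator L hint]
  simp [hL, integral_congr_ae (coeFn_lpCurve hY _), hmean, ouOperator]

end LpCurve

section FractionalBrownianMotion

variable {Ω : Type*} [MeasurableSpace Ω] {P : Measure Ω}

namespace IsFractionalBrownianMotion

variable {B : ℝ → Ω → ℝ} {H : ℝ}

theorem memLp_const_mul (h : IsFractionalBrownianMotion B H P) (σ s : ℝ) :
    MemLp (fun ω => σ * B s ω) 2 P :=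
  (h.gaussian.hasGaussianLaw_eval s).memLp_two.const_mul σ

theorem isFractionalCurve (h : IsFractionalBrownianMotion B H P) {σ : ℝ} (hσ : 0 ≤ σ) :
    IsFractionalCurve (lpCurve (h.memLp_const_mul σ)) σ H := fun s t => by
  have hcov (s t : ℝ) : ∫ ω, σ * B s ω * (σ * B t ω) ∂P =
      σ ^ 2 * ((1 / 2) * (|s| ^ (2 * H) + |t| ^ (2 * H) - |s - t| ^ (2 * H))) := by
    simp only [← h.covariance_eq, ← integral_const_mul]
    congr with ω
    ring
  have hzero : (0 : ℝ) ^ (2 * H) = 0 := Real.zero_rpow (by linarith [h.hurst_pos])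
  refine (sq_eq_sq₀ (norm_nonneg _) (by positivity)).1 ?_
  rw [norm_sub_sq_real, ← real_inner_self_eq_norm_sq, ← real_inner_self_eq_norm_sq, mul_pow,
    ← Real.rpow_mul_natCast (abs_nonneg _)]
  simp only [inner_lpCurve, hcov, sub_self, abs_zero, hzero]
  push_cast
  rw [mul_comm H]
  ring

end IsFractionalBrownianMotion

namespace IsFOU

variable {X : ℝ → Ω → ℝ} {l σ H : ℝ}

theorem hurst_pos (h : IsFOU X l σ H P) : 0 < H :=
  let ⟨_, hB, _⟩ := h.exists_fbm
  hB.hurst_pos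

theorem exists_ae_eq_ouOperator (h : IsFOU X l σ H P) :
    ∃ b : ℝ → Lp ℝ 2 P, IsFractionalCurve b σ H ∧ (∀ t, ∫ ω, ouOperator l b t ω ∂P = 0) ∧
      ∀ t, X t =ᵐ[P] (ouOperator l b t : Lp ℝ 2 P) := by
  obtain ⟨hl, hσ, B, hB, hBX⟩ := h
  have hY := hB.memLp_const_mul σ
  have hcurve := hB.isFractionalCurve hσ.le
  have hcont := (hcurve.holderWith hB.hurst_pos.le).continuous (Real.toNNReal_pos.2 hB.hurst_pos)
  have := hB.gaussian.isProbabilityMeasure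
  refine ⟨lpCurve hY, hcurve, fun t => ?_, fun t => ?_⟩
  · refine integral_ouOperator_lpCurve hY (fun s => ?_)
      (hcurve.integrable_comp_sub_expMeasure hB.hurst_pos hl t)
    rw [integral_const_mul, hB.centered, mul_zero]
  · exact ae_eq_ouOperator_of_isOUOperatorValue hY hcont
      (hcurve.tendsto_ouIntegral_atBot hB.hurst_pos hl t) (hBX t)

theorem memLp (h : IsFOU X l σ H P) (t : ℝ) : MemLp (X t) 2 P :=
  let ⟨_, _, _, hX⟩ := h.exists_ae_eq_ouOperator
  (memLp_congr_ae (hX t)).2 (Lp.memLp _)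

theorem integral_eq_zero (h : IsFOU X l σ H P) (t : ℝ) : ∫ ω, X t ω ∂P = 0 :=
  let ⟨_, _, hmean, hX⟩ := h.exists_ae_eq_ouOperator
  (integral_congr_ae (hX t)).trans (hmean t)

theorem integral_mul (h : IsFOU X l σ H P) (s t : ℝ) :
    ∫ ω, X s ω * X t ω ∂P = σ ^ 2 * H * fH H (l * |s - t|) / (2 * l ^ (2 * H)) := by
  obtain ⟨b, hb, -, hX⟩ := h.exists_ae_eq_ouOperator
  rw [← hb.inner_ouOperator h.hurst_pos h.lam_pos, inner_eq_integral_mul]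
  exact integral_congr_ae ((hX s).mul (hX t))

end IsFOU

end FractionalBrownianMotion

theorem fH_zero (H : ℝ) : fH H 0 = 2 * Real.Gamma (2 * H) := by
  simp [fH, fH1, fH2, two_mul]

theorem mainTheorem4_general {Ω : Type*} [MeasurableSpace Ω] {P : Measure Ω}
    {X : ℝ → Ω → ℝ} {lam σ H : ℝ} (hX : IsFOU X lam σ H P) :
    (∀ t, MemLp (X t) 2 P ∧ ∫ ω, X t ω ∂P = 0) ∧
    (∀ s t, ∫ ω, X s ω * X t ω ∂P = σ ^ 2 * H * fH H (lam * |s - t|) / (2 * lam ^ (2 * H))) ∧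
    (∀ t, Var[X t; P] = σ ^ 2 * Real.Gamma (2 * H + 1) / (2 * lam ^ (2 * H))) := by
  refine ⟨fun t => ⟨hX.memLp t, hX.integral_eq_zero t⟩, hX.integral_mul, fun t => ?_⟩
  have hvar : Var[X t; P] = ∫ ω, X t ω * X t ω ∂P := by
    simp only [variance_of_integral_eq_zero (hX.memLp t).aemeasurable (hX.integral_eq_zero t), sq]
  have hH : 2 * H ≠ 0 := (mul_pos two_pos hX.hurst_pos).ne'
  rw [hvar, hX.integral_mul, sub_self, abs_zero, mul_zero, fH_zero, Real.Gamma_add_one hH]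
  ring

theorem mainTheorem4 {Ω : Type*} [MeasurableSpace Ω] (P : Measure Ω) [IsProbabilityMeasure P]
    (X : ℝ → Ω → ℝ) (lam σ H : ℝ) (hX : IsFOU X lam σ H P) (hH : 1 / 2 < H) :
    (∀ t, MemLp (X t) 2 P ∧ ∫ ω, X t ω ∂P = 0) ∧
    (∀ t, ∫ ω, X 0 ω * X t ω ∂P = σ ^ 2 * H * fH H (lam * |t|) / (2 * lam ^ (2 * H))) ∧
    (∀ t, Var[X t; P] = σ ^ 2 * Real.Gamma (2 * H + 1) / (2 * lam ^ (2 * H))) := by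
  obtain ⟨hmoments, hcov, hvar⟩ := mainTheorem4_general hX
  exact ⟨hmoments, fun t => by simpa using hcov 0 t, hvar⟩
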